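/- Let $\mathbb{P}$ be the uniform measure on $(2^{\mathbb N})^{\mathbb N}$, i.e. the product over $\mathbb N$ of the fair-coin measures on $2^{\mathbb N}$. For $\omega=(\omega_0,\omega_1,\dots)\in(2^{\mathbb N})^{\mathbb N}$ write $\omega_{<n}=(\omega_0,\dots,\omega_{n-1})$, and for $\mathbb P$-integrable $f:(2^{\mathbb N})^{\mathbb N}\to\mathbb R$ put $$\mathbb E_n(f)(\omega)=\int f(\omega_{<n}{}^\frown\xi)\,d\mathbb P(\xi).$$ A *martingale* is a sequence $(M_n)_{n\in\mathbb N}$ of integrable functions $M_n:(2^{\mathbb N})^{\mathbb N}\to\mathbb R$ such that, almost surely, $M_n(\omega)$ depends only on $n$ and $\omega_{<n}$, and $\mathbb E_m(M_n)=M_m$ for all $m\le n$. It is a *computable martingale* if moreover, for every $\omega$ and $n$, (a Cauchy name of) $M_n(\omega)$ is computable from $n$ and $\omega_{<n}$, by one algorithm for all $n$ and $\omega$. Fix a standard enumeration $(q_i)_{i\in\mathbb N}$ of $\mathbb Q$. A *computable rational-valued martingale* is a martingale with $M_n(\omega)=q_{g(n,\omega_{<n})}$ for all $n$ and $\omega$,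 for some total computable $\mathbb N$-valued function $g$ (so the rational value is output exactly). A martingale is *nonnegative* if $M_n(\omega)\ge 0$ for all $n$ and $\omega$. A point $\omega$ is *Doob random* if $(M_n(\omega))$ converges in $\mathbb R$ as $n\to\infty$ for every nonnegative computable martingale $(M_n)$. **Theorem.** For every $\omega\in(2^{\mathbb N})^{\mathbb N}$ the following are equivalent: 1. $\omega$ is not Doob random. 2. $(M_n(\omega))$ diverges (does not converge to a real number) as $n\to\infty$ for some computable rational-valued nonnegative martingale $(M_n)$. 3. $\limsup_n M_n(\omega)=\infty$ for some computable rational-valued nonnegative martingale $(M_n)$. 4. $\liminf_n M_n(\omega)=\infty$ for some computable rational-valued nonnegative martingale $(M_n)$. -/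

import Mathlib

namespace DoobSeq

open MeasureTheory Filter

/-- The space `(2^ℕ)^ℕ` of sequences of infinite binary sequences. It carries the product
topology and the product measurable space. -/
abbrev Space : Type := ℕ → ℕ → Bool

/-- The fair-coin measure on `{0, 1}`. -/
noncomputable def fairCoin : Measure Bool := (PMF.uniformOfFintype Bool).toMeasure

instance : IsProbabilityMeasure fairCoin := by
  unfold fairCoin; infer_instance

/-- The uniform measure on `(2^ℕ)^ℕ`: the product of the products of the fair-coin measures. -/
noncomputable def P : Measure Space :=
  Measure.infinitePi fun _ : ℕ => Measure.infinitePi fun _ : ℕ => fairCoin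

/-- `ω` and `ω'` have the same first `n` sequences, that is, `ω_{<n} = ω'_{<n}`. -/
def AgreeBelow (n : ℕ) (ω ω' : Space) : Prop := ∀ i < n, ω i = ω' i

/-- The concatenation `ω_{<n} ⌢ ξ`. -/
def concat (n : ℕ) (ω ξ : Space) : Space := fun i => if i < n then ω i else ξ (i - n)

/-- The conditional expectation `𝔼_n(f)(ω) = ∫ f(ω_{<n} ⌢ ξ) dP(ξ)`. -/
noncomputable def condExpectation (n : ℕ) (f : Space → ℝ) (ω : Space) : ℝ :=
  ∫ ξ, f (concat n ω ξ) ∂P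

/-- Martingales on `(2^ℕ)^ℕ`: almost surely, `M_n(ω)` depends only on `n` and `ω_{<n}`, and
`𝔼_m(M_n) = M_m` for `m ≤ n`. -/
structure IsMartingale (M : ℕ → Space → ℝ) : Prop where
  integrable : ∀ n, Integrable (M n) P
  adapted : ∀ n, ∃ g : Space → ℝ,
    (∀ ω ω', AgreeBelow n ω ω' → g ω = g ω') ∧ M n =ᵐ[P] g
  condExpectation_eq : ∀ m n, m ≤ n → condExpectation m (M n) =ᵐ[P] M m

/-- The identification `ω ↦ ⨁ₙ ωₙ` of `(2^ℕ)^ℕ` with `2^ℕ` through a pairing function. -/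
def directSum (ω : Space) : ℕ → Bool := fun i => ω i.unpair.1 i.unpair.2

/-- The first `k` bits of `α`. -/
def initialBits (α : ℕ → Bool) (k : ℕ) : List Bool := (List.range k).map α

/-- Computability (as in type-two computability) of `F(ω, x) ∈ ℕ`, for an infinite input
`ω ∈ (2^ℕ)^ℕ` and a finite input `x`: one algorithm `φ`, the same for all `ω`, is fed longer and
longer finite parts of `ω`; it may answer `none` (not enough bits, or not enough time, yet), must
answer at some point, and every answer it gives is `F(ω, x)`. -/
def ComputableFunctional {X : Type} [Primcodable X] (F : Space → X → ℕ) : Prop :=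
  ∃ φ : List Bool → X → Option ℕ, Computable₂ φ ∧ ∀ (ω : Space) (x : X),
    (∃ k, φ (initialBits (directSum ω) k) x = some (F ω x)) ∧
    ∀ k y, φ (initialBits (directSum ω) k) x = some y → y = F ω x

/-- A standard enumeration `(q_i)` of the rationals (with repetitions): if `i` codes `((a, b), c)`
then `q_i = (a - b) / (c + 1)`. -/
def q (i : ℕ) : ℚ :=
  ((i.unpair.1.unpair.1 : ℚ) - (i.unpair.1.unpair.2 : ℚ)) / ((i.unpair.2 : ℚ) + 1)

theorem q_surjective : Function.Surjective q := by
  intro r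
  refine ⟨Nat.pair (Nat.pair r.num.toNat (-r.num).toNat) (r.den - 1), ?_⟩
  have h1 : ((r.den - 1 : ℕ) : ℚ) + 1 = r.den := by
    have := r.den_pos
    exact_mod_cast Nat.sub_add_cancel this
  have h2 : (r.num.toNat : ℚ) - ((-r.num).toNat : ℚ) = r.num := by
    have : (r.num.toNat : ℤ) - ((-r.num).toNat : ℤ) = r.num := by omega
    exact_mod_cast this
  simp only [q, Nat.unpair_pair, h1, h2]
  exact r.num_div_den

/-- `p ∈ ℕ^ℕ` is a Cauchy name of the real number `x`. -/
def IsCauchyName (p : ℕ → ℕ) (x : ℝ) : Prop :=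
  (∀ m n, m ≤ n → |(q (p n) : ℝ) - (q (p m) : ℝ)| ≤ (2 : ℝ)⁻¹ ^ m) ∧
  Tendsto (fun n => (q (p n) : ℝ)) atTop (nhds x)

/-- `ω_{<n}`, as an input of an algorithm: the remaining sequences are replaced by zeros. -/
def truncate (n : ℕ) (ω : Space) : Space := concat n ω fun _ _ => false

/-- `(M_n)` is computably adapted: (a name of) `M_n(ω)` is computable from `n` and `ω_{<n}`,
uniformly in `n` and `ω`. -/
def ComputablyAdapted (M : ℕ → Space → ℝ) : Prop :=
  ∃ F : Space → ℕ × ℕ → ℕ, ComputableFunctional F ∧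
    ∀ n ω, IsCauchyName (fun k => F (truncate n ω) (n, k)) (M n ω)

/-- Computable martingales. -/
def IsComputableMartingale (M : ℕ → Space → ℝ) : Prop :=
  IsMartingale M ∧ ComputablyAdapted M

/-- Computable rational-valued martingales: `M_n(ω) = q_{g(n, ω_{<n})}` with `g` computable. -/
def IsComputableRationalMartingale (M : ℕ → Space → ℝ) : Prop :=
  IsMartingale M ∧ ∃ g : Space → ℕ → ℕ, ComputableFunctional g ∧
    ∀ n ω, M n ω = (q (g (truncate n ω) n) : ℝ)

/-- The sequence of functions `(M_n)` is nonnegative. -/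
def Nonneg (M : ℕ → Space → ℝ) : Prop := ∀ n ω, 0 ≤ M n ω

/-- `(M_n(ω))` converges (to a real number) as `n → ∞`. -/
def ConvergesAt (M : ℕ → Space → ℝ) (ω : Space) : Prop :=
  ∃ l : ℝ, Tendsto (fun n => M n ω) atTop (nhds l)

/-- Doob randomness. -/
def DoobRandom (ω : Space) : Prop :=
  ∀ M : ℕ → Space → ℝ, IsComputableMartingale M → Nonneg M → ConvergesAt M ω

end DoobSeq

namespace DoobSeq

open MeasureTheory Filter Topology

/-! Only the passage from divergence of a real-valued martingale `M` to infinite limit of a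
rational-valued one has content. By compactness, an algorithm that answers on every input reads a
bounded number of bits, and a bound can be found by testing all strings of a given length
(`exists_computable_modulus`). So `M_n` has rational approximations `A_n`, within `2^{-(n+3)}`, that
depend on `K_n` bits, with `K` computable. Conditional expectations of `A_n` are then finite
averages, hence exactly computable rationals (`condExpectation_of_dependsOnBits`).

The approximations need not form a martingale, but `A_0 + 1 + ∑ (A_{i+1} - 𝔼_i(A_{i+1}))` does. The
errors are summable, so this "price" differs from `M` by a convergent sequence and stays within
`1/2` of `M + 1`: it is nonnegative and diverges wherever `M` does (`abs_price_sub_le`,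
`convergesAt_of_price`).

A nonnegative divergent sequence of reals tends to infinity or crosses some rational interval `[a,
b]` infinitely often. In the second case Doob's strategy, buying at most at `a` and selling at least
at `b`, gives a nonnegative capital that tends to infinity (`tendsto_capital`). Its comparisons are
decidable because the prices are exact rationals. The sum of capital and price is one martingale
that serves both cases. -/

/-- The inverse of `directSum`. -/
def toSpace (α : ℕ → Bool) : Space := fun a j => α (Nat.pair a j)

@[simp] theorem directSum_toSpace (α : ℕ → Bool) : directSum (toSpace α) = α := by
  funext i; simp [directSum, toSpace]

@[simp] theorem toSpace_directSum (ω : Space) : toSpace (directSum ω) = ω := by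
  funext a j; simp [directSum, toSpace]

/-! ### Finite prefixes of binary sequences -/

theorem initialBits_eq_iff {α β : ℕ → Bool} {k : ℕ} :
    initialBits α k = initialBits β k ↔ ∀ i < k, α i = β i := by
  simp [initialBits]

@[simp] theorem length_initialBits (α : ℕ → Bool) (k : ℕ) : (initialBits α k).length = k := by
  simp [initialBits]

theorem take_initialBits (α : ℕ → Bool) {j k : ℕ} (h : j ≤ k) :
    (initialBits α k).take j = initialBits α j := by
  simp [initialBits, ← List.map_take, List.take_range, h]

theorem getD_initialBits (α : ℕ → Bool) {i k : ℕ} (h : i < k) :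
    (initialBits α k).getD i false = α i := by
  simp [initialBits, List.getD, h]

/-- Every finite binary string of length `k` is given by the binary digits of some `t < 2 ^ k`. -/
theorem bijective_testBit (k : ℕ) :
    Function.Bijective fun (t : Fin (2 ^ k)) (i : Fin k) => (t : ℕ).testBit i := by
  rw [Fintype.bijective_iff_injective_and_card]
  refine ⟨fun s t h => ?_, by simp⟩
  apply Fin.ext
  apply Nat.eq_of_testBit_eq
  intro i
  by_cases hi : i < k
  · exact congrFun h ⟨i, hi⟩
  · have hk : 2 ^ k ≤ 2 ^ i := Nat.pow_le_pow_right (by norm_num) (by omega)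
    rw [Nat.testBit_lt_two_pow (s.2.trans_le hk), Nat.testBit_lt_two_pow (t.2.trans_le hk)]

theorem exists_testBit_eq (α : ℕ → Bool) (k : ℕ) :
    ∃ t < 2 ^ k, initialBits t.testBit k = initialBits α k := by
  obtain ⟨t, ht⟩ := (bijective_testBit k).2 fun i => α i
  exact ⟨t, t.2, initialBits_eq_iff.2 fun i hi => congrFun ht ⟨i, hi⟩⟩

/-! ### The uniform measure and functions of finitely many bits -/

theorem measurable_directSum : Measurable directSum := by
  unfold directSum; fun_prop

instance : IsProbabilityMeasure P := by
  unfold P; infer_instance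

/-- Uncurrying turns the iterated product into a product over `ℕ × ℕ`, and the pairing function
reindexes it by `ℕ`. -/
theorem map_directSum : P.map directSum = Measure.infinitePi fun _ : ℕ => fairCoin := by
  have h1 := Measure.infinitePi_map_curry_symm (fun (_ : ℕ) (_ : ℕ) => fairCoin)
  have h2 := Measure.infinitePi_map_piCongrLeft (X := fun _ : ℕ => Bool) (fun _ : ℕ => fairCoin)
    Nat.pairEquiv
  rw [← h2, ← h1, Measure.map_map (by fun_prop) (by fun_prop)]
  refine congrArg (Measure.map · P) ?_
  funext ω i
  obtain ⟨⟨a, j⟩, rfl⟩ := Nat.pairEquiv.surjective i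
  rw [Function.comp_apply, MeasurableEquiv.coe_piCongrLeft, Equiv.piCongrLeft_apply_apply]
  simp [directSum, Function.uncurry]

theorem fairCoin_singleton (b : Bool) : fairCoin {b} = 2⁻¹ := by
  simp [fairCoin]

theorem map_initialBits (k : ℕ) (β : Fin k → Bool) :
    P.map (fun ξ (i : Fin k) => directSum ξ i) {β} = (2 ^ k)⁻¹ := by
  have h : Measurable fun (α : ℕ → Bool) (i : Fin k) => α i := by fun_prop
  have h' := Measure.map_map h measurable_directSum (μ := P)
  change _ = P.map (fun ξ (i : Fin k) => directSum ξ i) at h'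
  rw [← h', map_directSum, Measure.map_apply h (measurableSet_singleton _)]
  have : (fun (α : ℕ → Bool) (i : Fin k) => α i) ⁻¹' {β} =
      Set.pi (Finset.range k) fun i => {if h : i < k then β ⟨i, h⟩ else false} := by
    ext α
    simp only [Set.mem_preimage, Set.mem_singleton_iff, Set.mem_pi, Finset.coe_range, Set.mem_Iio,
      funext_iff, Fin.forall_iff]
    refine forall₂_congr fun i hi => ?_
    simp [hi]
  rw [this, Measure.infinitePi_pi _ (fun _ _ => measurableSet_singleton _)]
  simp [fairCoin_singleton, ENNReal.inv_pow]

/-- `f(ω)` is determined by the first `K` bits of `ω`. -/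
def DependsOnBits {β : Type*} (K : ℕ) (f : Space → β) : Prop :=
  ∀ ω ω', (∀ i < K, directSum ω i = directSum ω' i) → f ω = f ω'

theorem DependsOnBits.exists_factor {β : Type*} {K : ℕ} {f : Space → β}
    (hf : DependsOnBits K f) :
    ∃ Q : (Fin K → Bool) → β, f = fun ξ => Q fun i => directSum ξ i := by
  refine ⟨fun β => f (toSpace fun i => if h : i < K then β ⟨i, h⟩ else false), ?_⟩
  funext ξ
  apply hf
  intro i hi
  simp [hi]

theorem measurable_bits (K : ℕ) : Measurable fun ξ (i : Fin K) => directSum ξ i := by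
  unfold directSum; fun_prop

theorem continuous_bits (K : ℕ) : Continuous fun ξ (i : Fin K) => directSum ξ i := by
  unfold directSum; fun_prop

theorem DependsOnBits.continuous {β : Type*} [TopologicalSpace β] {K : ℕ} {f : Space → β}
    (hf : DependsOnBits K f) : Continuous f := by
  obtain ⟨Q, rfl⟩ := hf.exists_factor
  exact continuous_of_discreteTopology.comp (continuous_bits K)

/-- The first `K` bits are uniformly distributed on the `2 ^ K` strings, and these are enumerated by
the binary digits of `t < 2 ^ K`. -/
theorem DependsOnBits.integral_eq {K : ℕ} {f : Space → ℝ} (hf : DependsOnBits K f) :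
    ∫ ξ, f ξ ∂P = (∑ t ∈ Finset.range (2 ^ K), f (toSpace t.testBit)) / 2 ^ K := by
  obtain ⟨Q, rfl⟩ := hf.exists_factor
  have := integral_map (μ := P) (measurable_bits K).aemeasurable (f := Q)
    (measurable_of_finite Q).aestronglyMeasurable
  rw [← this]
  have : IsProbabilityMeasure (P.map fun ξ (i : Fin K) => directSum ξ i) :=
    Measure.isProbabilityMeasure_map (measurable_bits K).aemeasurable
  rw [integral_fintype .of_finite]
  simp only [measureReal_def, map_initialBits, directSum_toSpace]
  rw [Finset.sum_range (f := fun t => Q fun i => t.testBit i),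
    (bijective_testBit K).sum_comp (g := Q), Finset.sum_div]
  refine Finset.sum_congr rfl fun β _ => ?_
  simp [div_eq_inv_mul]

theorem integrable_of_continuous {f : Space → ℝ} (hf : Continuous f) : Integrable f P := by
  have := (BoundedContinuousFunction.mkOfCompact ⟨f, hf⟩).integrable P
  exact this

/-- A nonempty open set contains a cylinder given by finitely many bits, of measure `2^{-K}`. This
lets almost sure identities between continuous functions be upgraded to identities everywhere. -/
instance : Measure.IsOpenPosMeasure P := by
  refine ⟨fun U hU ⟨ω, hω⟩ => ?_⟩
  obtain ⟨K, hK⟩ : ∃ K, ∀ ω', (∀ i < K, directSum ω' i = directSum ω i) → ω' ∈ U := by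
    have hV : IsOpen (toSpace ⁻¹' U) := hU.preimage (by unfold toSpace; fun_prop)
    obtain ⟨I, u, hu, hsub⟩ := isOpen_pi_iff.1 hV (directSum ω) (by simpa using hω)
    refine ⟨I.sup id + 1, fun ω' h => ?_⟩
    have : directSum ω' ∈ toSpace ⁻¹' U := hsub fun i hi => by
      rw [h i (Nat.lt_succ_of_le (Finset.le_sup (f := id) hi))]
      exact (hu i hi).2
    simpa using this
  have h1 := map_initialBits K fun i : Fin K => directSum ω i
  rw [Measure.map_apply (measurable_bits K) (measurableSet_singleton _)] at h1
  intro h0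
  have h2 := measure_mono_null (μ := P)
    (s := (fun ξ (i : Fin K) => directSum ξ i) ⁻¹' {fun i : Fin K => directSum ω i}) (fun ω' h => hK ω'
      fun i hi => congrFun (Set.mem_singleton_iff.1 h) ⟨i, hi⟩) h0
  simp [h1] at h2

/-! ### Concatenation -/

theorem continuous_concat (n : ℕ) : Continuous fun p : Space × Space => concat n p.1 p.2 := by
  refine continuous_pi fun i => ?_
  unfold concat
  split_ifs <;> fun_prop

theorem continuous_concat_right (n : ℕ) (ω : Space) : Continuous (concat n ω) :=
  (continuous_concat n).comp (Continuous.prodMk_right ω)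

theorem continuous_truncate (n : ℕ) : Continuous (truncate n) :=
  (continuous_concat n).comp (Continuous.prodMk_left _)

theorem concat_concat {m n : ℕ} (h : m ≤ n) (ω ξ η : Space) :
    concat n (concat m ω ξ) η = concat m ω (concat (n - m) ξ η) := by
  funext i
  simp only [concat]
  split_ifs <;> first | rfl | omega | (congr 1; omega)

theorem AgreeBelow.concat_eq {n : ℕ} {ω ω' : Space} (h : AgreeBelow n ω ω') (ξ : Space) :
    concat n ω ξ = concat n ω' ξ := by
  funext i
  simp only [concat]
  split_ifs with hi
  · exact h i hi
  · rfl

theorem agreeBelow_concat (n : ℕ) (ω ξ : Space) : AgreeBelow n (concat n ω ξ) ω := by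
  intro i hi; simp [concat, hi]

theorem agreeBelow_truncate (n : ℕ) (ω : Space) : AgreeBelow n (truncate n ω) ω :=
  agreeBelow_concat _ _ _

theorem measurePreserving_concat (d : ℕ) :
    MeasurePreserving (fun p : Space × Space => concat d p.1 p.2) (P.prod P) P := by
  refine ⟨(continuous_concat d).measurable, ?_⟩
  refine Measure.eq_infinitePi _ fun s t ht => ?_
  rw [Measure.map_apply (continuous_concat d).measurable
    (MeasurableSet.pi s.countable_toSet fun i _ => ht i)]
  -- The preimage of a box is a product of two boxes: coordinates below `d` constrain the first
  -- factor, the others, shifted by `d`, the second.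
  have : (fun p : Space × Space => concat d p.1 p.2) ⁻¹' (Set.pi s t) =
      Set.pi (s.filter (· < d)) t ×ˢ
      Set.pi ((s.filter (¬ · < d)).image (· - d)) fun i => t (i + d) := by
    ext ⟨ξ, η⟩
    simp only [Set.mem_preimage, Set.mem_pi, Set.mem_prod, Finset.mem_coe, Finset.mem_filter,
      Finset.mem_image, concat]
    constructor
    · intro h
      refine ⟨fun i hi => by simpa [hi.2] using h i hi.1, ?_⟩
      rintro _ ⟨i, ⟨hi, hid⟩, rfl⟩
      have := h i hi
      rw [if_neg hid] at this
      rwa [Nat.sub_add_cancel (by omega)]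
    · rintro ⟨h1, h2⟩ i hi
      split_ifs with hid
      · exact h1 i ⟨hi, hid⟩
      · have := h2 (i - d) ⟨i, ⟨hi, hid⟩, rfl⟩
        rwa [Nat.sub_add_cancel (by omega)] at this
  rw [this, Measure.prod_prod]
  unfold P
  rw [Measure.infinitePi_pi _ fun i _ => ht i, Measure.infinitePi_pi _ fun i _ => ht _,
    Finset.prod_image, ← Finset.prod_filter_mul_prod_filter_not s (· < d)]
  · congr 1
    refine Finset.prod_congr rfl fun i hi => ?_
    rw [Nat.sub_add_cancel (by simpa using (Finset.mem_filter.1 hi).2)]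
  · intro i hi j hj hij
    replace hi := (Finset.mem_filter.1 hi).2
    replace hj := (Finset.mem_filter.1 hj).2
    simp only at hij
    omega

/-- Tower property: by Fubini the iterated integral is one over pairs, and concatenation of
independent uniform points is uniform. -/
theorem condExpectation_condExpectation {m n : ℕ} (h : m ≤ n) {f : Space → ℝ} (hf : Continuous f)
    (ω : Space) : condExpectation m (condExpectation n f) ω = condExpectation m f ω := by
  unfold condExpectation
  simp only [concat_concat h]
  have hg : Continuous fun ξ => f (concat m ω ξ) := hf.comp (continuous_concat_right m ω)
  have hc := (measurePreserving_concat (n - m)).integrable_comp_of_integrable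
    (integrable_of_continuous hg)
  have h1 := integral_prod _ hc
  simp only [Function.comp_apply] at h1
  rw [← h1]
  have h2 := integral_map (measurePreserving_concat (n - m)).measurable.aemeasurable
    (f := fun ξ => f (concat m ω ξ)) (μ := P.prod P) hg.aestronglyMeasurable
  rw [(measurePreserving_concat (n - m)).map_eq] at h2
  exact h2.symm

theorem continuous_condExpectation (n : ℕ) {f : Space → ℝ} (hf : Continuous f) :
    Continuous (condExpectation n f) := by
  obtain ⟨C, hC⟩ := isCompact_univ.exists_bound_of_continuousOn hf.continuousOn
  refine continuous_of_dominated (bound := fun _ => C) (fun ω =>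
    (hf.comp (continuous_concat_right n ω)).aestronglyMeasurable)
    (fun ω => .of_forall fun ξ => hC _ trivial) (integrable_const C)
    (.of_forall fun ξ => hf.comp ((continuous_concat n).comp (Continuous.prodMk_left ξ)))

theorem condExpectation_of_agreeBelow {n : ℕ} {f : Space → ℝ}
    (hf : ∀ ω ω', AgreeBelow n ω ω' → f ω = f ω') (ω : Space) : condExpectation n f ω = f ω := by
  unfold condExpectation
  rw [integral_congr_ae (.of_forall fun ξ => hf _ _ (agreeBelow_concat n ω ξ))]
  simp

/-- A continuous adapted sequence with the one-step martingale property is a martingale. -/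
theorem isMartingale_of_step {X : ℕ → Space → ℝ} (hX : ∀ n, Continuous (X n))
    (hadapted : ∀ n ω ω', AgreeBelow n ω ω' → X n ω = X n ω')
    (hstep : ∀ n ω, condExpectation n (X (n + 1)) ω = X n ω) : IsMartingale X := by
  refine ⟨fun n => integrable_of_continuous (hX n), fun n => ⟨X n, hadapted n, .rfl⟩, ?_⟩
  intro m n hmn
  refine .of_forall fun ω => ?_
  induction n, hmn using Nat.le_induction with
  | base => exact condExpectation_of_agreeBelow (hadapted m) ω
  | succ n hmn ih =>
    rw [← condExpectation_condExpectation hmn (hX _), funext (hstep n)]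
    exact ih

/-- For continuous functions the martingale property holds everywhere. -/
theorem IsMartingale.condExpectation_eq_of_continuous {M : ℕ → Space → ℝ} (hM : IsMartingale M)
    (hc : ∀ n, Continuous (M n)) {m n : ℕ} (h : m ≤ n) : condExpectation m (M n) = M m :=
  (continuous_condExpectation m (hc n)).ae_eq_iff_eq P (hc m) |>.1 (hM.condExpectation_eq m n h)

/-! ### Arithmetic on codes of rationals -/

/-- The code of `(a - b) / (c + 1)`. -/
def qmk (a b c : ℕ) : ℕ := Nat.pair (Nat.pair a b) c

/-- The positive part `a` of the numerator in the code of `(a - b) / (c + 1)`. -/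
def qpos (i : ℕ) : ℕ := i.unpair.1.unpair.1

/-- The negative part `b` of the numerator in the code of `(a - b) / (c + 1)`. -/
def qneg (i : ℕ) : ℕ := i.unpair.1.unpair.2

/-- The denominator in the code of `(a - b) / (c + 1)`. -/
def qden (i : ℕ) : ℕ := i.unpair.2 + 1

/-- Addition on codes of rationals. -/
def qadd (i j : ℕ) : ℕ :=
  qmk (qpos i * qden j + qpos j * qden i) (qneg i * qden j + qneg j * qden i) (qden i * qden j - 1)

/-- Subtraction on codes of rationals. -/
def qsub (i j : ℕ) : ℕ :=
  qmk (qpos i * qden j + qneg j * qden i) (qneg i * qden j + qpos j * qden i) (qden i * qden j - 1)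

/-- Division of a code of a rational by a positive natural number. -/
def qdivNat (i d : ℕ) : ℕ := qmk (qpos i) (qneg i) (qden i * d - 1)

/-- Comparison of codes of rationals. -/
def qle (i j : ℕ) : Bool :=
  decide (qpos i * qden j + qneg j * qden i ≤ qpos j * qden i + qneg i * qden j)

theorem q_eq (i : ℕ) : q i = ((qpos i : ℚ) - qneg i) / qden i := by
  simp [q, qpos, qneg, qden]

theorem qden_pos (i : ℕ) : 0 < qden i := Nat.succ_pos _

/-- Codes store the denominator minus one, whence the predecessor here and in the arithmetic
operations. -/
theorem q_qmk (a b : ℕ) {d : ℕ} (hd : 0 < d) : q (qmk a b (d - 1)) = ((a : ℚ) - b) / d := by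
  have : ((d - 1 : ℕ) : ℚ) + 1 = d := by exact_mod_cast Nat.sub_add_cancel hd
  simp [q, qmk, this]

theorem q_zero : q 0 = 0 := by simp [q]

theorem q_qadd (i j : ℕ) : q (qadd i j) = q i + q j := by
  have hi : (qden i : ℚ) ≠ 0 := by exact_mod_cast (qden_pos i).ne'
  have hj : (qden j : ℚ) ≠ 0 := by exact_mod_cast (qden_pos j).ne'
  rw [qadd, q_qmk _ _ (Nat.mul_pos (qden_pos i) (qden_pos j)), q_eq, q_eq]
  push_cast
  field_simp
  ring

theorem q_qsub (i j : ℕ) : q (qsub i j) = q i - q j := by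
  have hi : (qden i : ℚ) ≠ 0 := by exact_mod_cast (qden_pos i).ne'
  have hj : (qden j : ℚ) ≠ 0 := by exact_mod_cast (qden_pos j).ne'
  rw [qsub, q_qmk _ _ (Nat.mul_pos (qden_pos i) (qden_pos j)), q_eq, q_eq]
  push_cast
  field_simp
  ring

theorem q_qdivNat (i : ℕ) {d : ℕ} (hd : 0 < d) : q (qdivNat i d) = q i / d := by
  rw [qdivNat, q_qmk _ _ (Nat.mul_pos (qden_pos i) hd), q_eq, div_div, Nat.cast_mul]

theorem qle_eq (i j : ℕ) : qle i j = decide (q i ≤ q j) := by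
  have hi : (0 : ℚ) < qden i := by exact_mod_cast qden_pos i
  have hj : (0 : ℚ) < qden j := by exact_mod_cast qden_pos j
  rw [qle, decide_eq_decide, q_eq, q_eq, div_le_div_iff₀ hi hj, ← Nat.cast_le (α := ℚ)]
  push_cast
  constructor <;> intro h <;> linarith

theorem primrec_qpos : Primrec qpos :=
  Primrec.fst.comp (Primrec.unpair.comp (Primrec.fst.comp Primrec.unpair))

theorem primrec_qneg : Primrec qneg :=
  Primrec.snd.comp (Primrec.unpair.comp (Primrec.fst.comp Primrec.unpair))

theorem primrec_qden : Primrec qden :=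
  Primrec.succ.comp (Primrec.snd.comp Primrec.unpair)

section

variable {α : Type*} [Primcodable α] {a b c : α → ℕ}

theorem primrec_qmk (ha : Primrec a) (hb : Primrec b) (hc : Primrec c) :
    Primrec fun x => qmk (a x) (b x) (c x) :=
  Primrec₂.natPair.comp (Primrec₂.natPair.comp ha hb) hc

theorem primrec_add_mul {a b c d : α → ℕ} (ha : Primrec a) (hb : Primrec b) (hc : Primrec c)
    (hd : Primrec d) : Primrec fun x => a x * b x + c x * d x :=
  Primrec.nat_add.comp (Primrec.nat_mul.comp ha hb) (Primrec.nat_mul.comp hc hd)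

end

theorem primrec_qadd : Primrec₂ qadd := by
  have p1 := primrec_qpos.comp (Primrec.fst (α := ℕ) (β := ℕ))
  have p2 := primrec_qpos.comp (Primrec.snd (α := ℕ) (β := ℕ))
  have n1 := primrec_qneg.comp (Primrec.fst (α := ℕ) (β := ℕ))
  have n2 := primrec_qneg.comp (Primrec.snd (α := ℕ) (β := ℕ))
  have d1 := primrec_qden.comp (Primrec.fst (α := ℕ) (β := ℕ))
  have d2 := primrec_qden.comp (Primrec.snd (α := ℕ) (β := ℕ))
  exact primrec_qmk (primrec_add_mul p1 d2 p2 d1) (primrec_add_mul n1 d2 n2 d1)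
    (Primrec.pred.comp (Primrec.nat_mul.comp d1 d2))

theorem primrec_qsub : Primrec₂ qsub := by
  have p1 := primrec_qpos.comp (Primrec.fst (α := ℕ) (β := ℕ))
  have p2 := primrec_qpos.comp (Primrec.snd (α := ℕ) (β := ℕ))
  have n1 := primrec_qneg.comp (Primrec.fst (α := ℕ) (β := ℕ))
  have n2 := primrec_qneg.comp (Primrec.snd (α := ℕ) (β := ℕ))
  have d1 := primrec_qden.comp (Primrec.fst (α := ℕ) (β := ℕ))
  have d2 := primrec_qden.comp (Primrec.snd (α := ℕ) (β := ℕ))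
  exact primrec_qmk (primrec_add_mul p1 d2 n2 d1) (primrec_add_mul n1 d2 p2 d1)
    (Primrec.pred.comp (Primrec.nat_mul.comp d1 d2))

theorem primrec_qdivNat : Primrec₂ qdivNat := by
  have f := Primrec.fst (α := ℕ) (β := ℕ)
  exact primrec_qmk (primrec_qpos.comp f) (primrec_qneg.comp f)
    (Primrec.pred.comp (Primrec.nat_mul.comp (primrec_qden.comp f) Primrec.snd))

theorem primrec_qle : Primrec₂ qle := by
  have p1 := primrec_qpos.comp (Primrec.fst (α := ℕ) (β := ℕ))
  have p2 := primrec_qpos.comp (Primrec.snd (α := ℕ) (β := ℕ))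
  have n1 := primrec_qneg.comp (Primrec.fst (α := ℕ) (β := ℕ))
  have n2 := primrec_qneg.comp (Primrec.snd (α := ℕ) (β := ℕ))
  have d1 := primrec_qden.comp (Primrec.fst (α := ℕ) (β := ℕ))
  have d2 := primrec_qden.comp (Primrec.snd (α := ℕ) (β := ℕ))
  exact (Primrec.nat_le.comp (primrec_add_mul p1 d2 n2 d1) (primrec_add_mul p2 d1 n1 d2)).decide

/-! ### Finite parts of points -/

/-- The first `K` bits of `ω_{<n}`, computed from a finite part `σ` of `ω`. -/
def restrictBits (K n : ℕ) (σ : List Bool) : List Bool :=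
  (List.range K).map fun i => decide (i.unpair.1 < n) && σ.getD i false

/-- The first `K` bits of `ω_{<n} ⌢ ξ`, computed from a finite part `σ` of `ω`, where the bits of
`ξ` are the binary digits of `t`. -/
def mergeBits (K n : ℕ) (σ : List Bool) (t : ℕ) : List Bool :=
  (List.range K).map fun i => bif decide (i.unpair.1 < n) then σ.getD i false
    else t.testBit (Nat.pair (i.unpair.1 - n) i.unpair.2)

theorem restrictBits_initialBits {K L : ℕ} (h : K ≤ L) (n : ℕ) (ω : Space) :
    restrictBits K n (initialBits (directSum ω) L) =
      initialBits (directSum (truncate n ω)) K := by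
  refine List.map_congr_left fun i hi => ?_
  rw [getD_initialBits _ ((List.mem_range.1 hi).trans_le h)]
  by_cases hn : i.unpair.1 < n <;> simp [directSum, truncate, concat, hn]

theorem mergeBits_initialBits {K L : ℕ} (h : K ≤ L) (n : ℕ) (ω : Space) (t : ℕ) :
    mergeBits K n (initialBits (directSum ω) L) t =
      initialBits (directSum (concat n ω (toSpace t.testBit))) K := by
  refine List.map_congr_left fun i hi => ?_
  rw [getD_initialBits _ ((List.mem_range.1 hi).trans_le h)]
  by_cases hn : i.unpair.1 < n <;> simp [directSum, toSpace, concat, hn]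

theorem primrec_two_pow : Primrec fun n : ℕ => 2 ^ n :=
  (Primrec₂.unpaired'.1 Nat.Primrec.pow).comp (Primrec.const 2) Primrec.id

theorem primrec_testBit : Primrec₂ Nat.testBit := by
  refine (Primrec.nat_bodd.comp (Primrec.nat_div.comp Primrec.fst
    (primrec_two_pow.comp Primrec.snd))).of_eq fun p => ?_
  simp [Nat.testBit, Nat.shiftRight_eq_div_pow, Nat.bodd_eq_one_and_ne_zero]

theorem primrec_unpair_fst_lt {α : Type*} [Primcodable α] {i n : α → ℕ} (hi : Primrec i)
    (hn : Primrec n) : Primrec fun x => decide ((i x).unpair.1 < n x) :=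
  (Primrec.nat_lt.comp (Primrec.fst.comp (Primrec.unpair.comp hi)) hn).decide

theorem primrec_restrictBits {α : Type*} [Primcodable α] {K n : α → ℕ} {σ : α → List Bool}
    (hK : Primrec K) (hn : Primrec n) (hσ : Primrec σ) :
    Primrec fun x => restrictBits (K x) (n x) (σ x) :=
  Primrec.list_map (Primrec.list_range.comp hK)
    (Primrec.and.comp (primrec_unpair_fst_lt Primrec.snd (hn.comp Primrec.fst))
      ((Primrec.list_getD false).comp (hσ.comp Primrec.fst) Primrec.snd))

theorem primrec_mergeBits {α : Type*} [Primcodable α] {K n : α → ℕ} {σ : α → List Bool}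
    {t : α → ℕ} (hK : Primrec K) (hn : Primrec n) (hσ : Primrec σ) (ht : Primrec t) :
    Primrec fun x => mergeBits (K x) (n x) (σ x) (t x) :=
  Primrec.list_map (Primrec.list_range.comp hK)
    (Primrec.cond (primrec_unpair_fst_lt Primrec.snd (hn.comp Primrec.fst))
      ((Primrec.list_getD false).comp (hσ.comp Primrec.fst) Primrec.snd)
      (primrec_testBit.comp (ht.comp Primrec.fst)
        (Primrec₂.natPair.comp
          (Primrec.nat_sub.comp (Primrec.fst.comp (Primrec.unpair.comp Primrec.snd))
            (hn.comp Primrec.fst))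
          (Primrec.snd.comp (Primrec.unpair.comp Primrec.snd)))))

theorem primrec_initialBits_testBit : Primrec₂ fun (t K : ℕ) => initialBits t.testBit K :=
  Primrec.list_map (Primrec.list_range.comp Primrec.snd)
    (primrec_testBit.comp (Primrec.fst.comp Primrec.fst) Primrec.snd)

/-! ### Moduli of continuity -/

section Answer

variable {X : Type} (φ : List Bool → X → Option ℕ)

/-- The first answer of the algorithm `φ` on the prefixes of `σ`. -/
def answer (σ : List Bool) (x : X) : Option ℕ :=
  Nat.rec none (fun j acc => acc <|> φ (σ.take j) x) (σ.length + 1)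

/-- `φ` may answer on a string and be silent on an extension of it; searching all prefixes makes
having answered monotone in the length. -/
theorem answer_initialBits_spec (α : ℕ → Bool) (x : X) (K : ℕ) :
    (∀ y, answer φ (initialBits α K) x = some y → ∃ k ≤ K, φ (initialBits α k) x = some y) ∧
    ((∃ k ≤ K, (φ (initialBits α k) x).isSome) → (answer φ (initialBits α K) x).isSome) := by
  set r : ℕ → Option ℕ := fun J =>
    Nat.rec none (fun j acc => acc <|> φ ((initialBits α K).take j) x) J with hr
  have hr1 : ∀ J ≤ K, r (J + 1) = (r J <|> φ (initialBits α J) x) := fun J hJ => by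
    simp only [hr, take_initialBits α hJ]
  have key : ∀ J ≤ K + 1, (∀ y, r J = some y → ∃ k < J, φ (initialBits α k) x = some y) ∧
      ((∃ k < J, (φ (initialBits α k) x).isSome) → (r J).isSome) := by
    intro J
    induction J with
    | zero => simp
    | succ J ih =>
      intro hJ
      obtain ⟨ih1, ih2⟩ := ih (by omega)
      rw [hr1 J (by omega)]
      cases hJr : r J with
      | some y =>
        obtain ⟨k, hk, hy⟩ := ih1 y hJr
        refine ⟨fun z hz => ⟨k, by omega, ?_⟩, by simp⟩
        replace hz : y = z := by simpa using hz
        exact hz ▸ hy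
      | none =>
        simp only [hJr, Option.isSome_none, Bool.false_eq_true, imp_false] at ih2
        refine ⟨fun y hy => ⟨J, by omega, by simpa using hy⟩, ?_⟩
        rintro ⟨k, hk, hs⟩
        rcases Nat.lt_succ_iff_lt_or_eq.1 hk with h | rfl
        · exact absurd ⟨k, h, hs⟩ ih2
        · simpa using hs
  have h := key (K + 1) le_rfl
  simp only [Nat.lt_succ_iff] at h
  rwa [answer, length_initialBits]

/-- Whether `φ` answers on all strings of length `K`. -/
def answersBelow (K : ℕ) (x : X) : Bool :=
  Nat.rec true (fun t acc => acc && (answer φ (initialBits t.testBit K) x).isSome) (2 ^ K)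

theorem answersBelow_iff {K : ℕ} {x : X} : answersBelow φ K x = true ↔
    ∀ t < 2 ^ K, (answer φ (initialBits t.testBit K) x).isSome := by
  unfold answersBelow
  induction 2 ^ K with
  | zero => simp
  | succ n ih => rw [Nat.forall_lt_succ_right, ← ih, Bool.and_eq_true]

variable {φ}

/-- Membership is decided by the first `K` bits. These sets increase with `K`, so compactness
applies to the cover they form. -/
theorem isOpen_answer (x : X) (K : ℕ) :
    IsOpen {α | ∃ k ≤ K, (φ (initialBits α k) x).isSome} := by
  have : {α | ∃ k ≤ K, (φ (initialBits α k) x).isSome} =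
      ⋃ k ∈ Set.Iic K, (fun (α : ℕ → Bool) (i : Fin k) => α i) ⁻¹'
        {β | (φ (List.ofFn β) x).isSome} := by
    ext α
    simp [initialBits, List.ofFn_eq_map, ← List.map_coe_finRange_eq_range, Function.comp_def]
  rw [this]
  refine isOpen_biUnion fun k _ => (isOpen_discrete _).preimage ?_
  fun_prop

/-- A total algorithm answers after reading a bounded number of bits. -/
theorem exists_answersBelow {x : X} {f : (ℕ → Bool) → ℕ}
    (hf : ∀ α, ∃ k, φ (initialBits α k) x = some (f α)) :
    ∃ K, answersBelow φ K x = true := by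
  obtain ⟨K, hK⟩ := isCompact_univ.elim_directed_cover
    (fun K => {α | ∃ k ≤ K, (φ (initialBits α k) x).isSome}) (isOpen_answer x)
    (fun α _ => by
      obtain ⟨k, hk⟩ := hf α
      exact Set.mem_iUnion.2 ⟨k, k, le_rfl, by simp [hk]⟩)
    (directed_of_isDirected_le fun a b hab α ⟨k, hk, hs⟩ => ⟨k, hk.trans hab, hs⟩)
  exact ⟨K, (answersBelow_iff φ).2 fun t _ =>
    (answer_initialBits_spec φ t.testBit x K).2 (hK (Set.mem_univ _))⟩

theorem answer_eq_some_of_answersBelow {x : X} {α : ℕ → Bool} {v K : ℕ}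
    (hv : ∀ k y, φ (initialBits α k) x = some y → y = v) (hK : answersBelow φ K x = true) :
    answer φ (initialBits α K) x = some v := by
  obtain ⟨t, ht, hta⟩ := exists_testBit_eq α K
  have hs := (answersBelow_iff φ).1 hK t ht
  rw [hta] at hs
  obtain ⟨y, hy⟩ := Option.isSome_iff_exists.1 hs
  obtain ⟨k, -, hk⟩ := (answer_initialBits_spec φ α x K).1 y hy
  rw [hy, hv k y hk]

theorem computable_answer [Primcodable X] (hφ : Computable₂ φ) : Computable₂ (answer φ) := by
  have h : Computable₂ fun (p : List Bool × X) (s : ℕ × Option ℕ) =>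
      s.2 <|> φ (p.1.take s.1) p.2 :=
    Computable₂.mk (Primrec.option_orElse.to_comp.comp (Computable.snd.comp Computable.snd)
      (hφ.comp (Primrec.list_take.to_comp.comp (Computable.fst.comp Computable.snd)
        (Computable.fst.comp Computable.fst)) (Computable.snd.comp Computable.fst)))
  exact Computable.nat_rec (Computable.succ.comp (Computable.list_length.comp Computable.fst))
    (Computable.const none) h

theorem computable_answersBelow [Primcodable X] (hφ : Computable₂ φ) :
    Computable₂ (answersBelow φ) := by
  have h : Computable₂ fun (p : ℕ × X) (s : ℕ × Bool) =>
      s.2 && (answer φ (initialBits s.1.testBit p.1) p.2).isSome :=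
    Computable₂.mk (Primrec.and.to_comp.comp (Computable.snd.comp Computable.snd)
      (Primrec.option_isSome.to_comp.comp ((computable_answer hφ).comp
        (primrec_initialBits_testBit.to_comp.comp (Computable.fst.comp Computable.snd)
          (Computable.fst.comp Computable.fst)) (Computable.snd.comp Computable.fst))))
  exact Computable.nat_rec (primrec_two_pow.to_comp.comp Computable.fst) (Computable.const true) h

/-- A number of bits after which `φ` has answered is computable. -/
theorem exists_computable_modulus [Primcodable X] (hφ : Computable₂ φ)
    (h : ∀ x, ∃ K, answersBelow φ K x = true) :
    ∃ K : X → ℕ, Computable K ∧ ∀ x, answersBelow φ (K x) x = true := by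
  refine ⟨fun x => Nat.find (h x), ?_, fun x => Nat.find_spec (h x)⟩
  have hc : Computable₂ fun (x : X) (K : ℕ) => answersBelow φ K x :=
    (computable_answersBelow hφ).comp Computable.snd Computable.fst
  refine (Partrec.rfind hc.partrec₂).of_eq_tot fun x => ?_
  refine Nat.mem_rfind.2 ⟨?_, fun hm => ?_⟩
  · exact Part.mem_some_iff.2 (Nat.find_spec (h x)).symm
  · exact Part.mem_some_iff.2 (Bool.eq_false_of_not_eq_true (Nat.find_min (h x) hm)).symm

end Answer

/-! ### The upcrossing strategy -/

/-- The state of a gambler trading in a process: her capital, the current price, and whether she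
holds a share. She buys when the price is at most `a` and sells when it is at least `b`. -/
abbrev State : Type := ℚ × ℚ × Bool

/-- The initial state at price `p`. -/
def State.init (a p : ℚ) : State := (a, p, decide (p ≤ a))

/-- The next state when the price changes by `d`. -/
def State.next (a b : ℚ) (s : State) (d : ℚ) : State :=
  (s.1 + bif s.2.2 then d else 0, s.2.1 + d,
    bif s.2.2 then !decide (b ≤ s.2.1 + d) else decide (s.2.1 + d ≤ a))

section Strategy

variable {a b : ℚ} {s : ℕ → State} {d : ℕ → ℚ}

/-- The capital of the gambler if shares are valued at the price `a`. -/
def State.bank (a : ℚ) (s : State) : ℚ := s.1 - bif s.2.2 then s.2.1 - a else 0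

/-- Valued at `a`, the holdings change only in trades: a purchase at a price at most `a` loses
nothing, and a sale at a price at least `b` gains at least `b - a`. -/
theorem State.bank_next (s : State) (d : ℚ) :
    s.bank a + (bif s.2.2 && !(s.next a b d).2.2 then b - a else 0) ≤ (s.next a b d).bank a := by
  obtain ⟨T, N, h⟩ := s
  cases h
  · by_cases h : N + d ≤ a <;> simp [bank, next, h]
  · by_cases h : b ≤ N + d <;> simp [bank, next, h]
    · linarith
    · linarith

theorem monotone_bank (hab : a ≤ b) (hs : ∀ n, s (n + 1) = (s n).next a b (d n)) :
    Monotone fun n => (s n).bank a := by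
  refine monotone_nat_of_le_succ fun n => ?_
  have := State.bank_next (a := a) (b := b) (s n) (d n)
  rw [hs]
  refine le_trans ?_ this
  cases (s n).2.2 && !((s n).next a b (d n)).2.2 <;> simp [hab]

/-- A share held at time `m` and no share at time `n` means that a sale took place in between. -/
theorem bank_add_le (hab : a ≤ b) (hs : ∀ n, s (n + 1) = (s n).next a b (d n)) {m n : ℕ}
    (hmn : m ≤ n) (hm : (s m).2.2 = true) :
    (s m).bank a + (bif (s n).2.2 then 0 else b - a) ≤ (s n).bank a := by
  induction n, hmn using Nat.le_induction with
  | base => simp [hm]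
  | succ n hmn ih =>
    have h1 := State.bank_next (a := a) (b := b) (s n) (d n)
    rw [← hs] at h1
    cases hn : (s n).2.2 <;> cases hn' : (s (n + 1)).2.2 <;> simp [hn, hn'] at h1 ih ⊢ <;> linarith

theorem bank_init (p : ℚ) : a ≤ (State.init a p).bank a := by
  by_cases h : p ≤ a <;> simp [State.bank, State.init, h]

/-- The capital of the gambler is at least the banked capital, up to the constant `a`. -/
theorem bank_sub_le_capital (ha : 0 ≤ a) (s : State) (hs : 0 ≤ s.2.1) : s.bank a - a ≤ s.1 := by
  obtain ⟨T, N, h⟩ := s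
  simp only at hs
  cases h <;> simp [State.bank] <;> linarith

/-- The initial capital `a` covers the greatest possible loss on a share bought at a price at most
`a`: the bank starts at `a` or more, never decreases, and exceeds the capital by at most `a`. -/
theorem capital_nonneg (ha : 0 ≤ a) (hab : a ≤ b) {p : ℚ} (h0 : s 0 = State.init a p)
    (hs : ∀ n, s (n + 1) = (s n).next a b (d n)) (hp : ∀ n, 0 ≤ (s n).2.1) (n : ℕ) :
    0 ≤ (s n).1 := by
  have h1 := monotone_bank hab hs (Nat.zero_le n)
  have h2 := bank_init (a := a) p
  have h3 := bank_sub_le_capital ha (s n) (hp n)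
  simp only [h0] at h1
  linarith

theorem holds_of_le (hab : a < b) {p : ℚ} (h0 : s 0 = State.init a p)
    (hs : ∀ n, s (n + 1) = (s n).next a b (d n)) {n : ℕ} (h : (s n).2.1 ≤ a) :
    (s n).2.2 = true := by
  cases n with
  | zero => rw [h0] at h ⊢; simpa [State.init] using h
  | succ n =>
    rw [hs] at h ⊢
    simp only [State.next] at h ⊢
    cases (s n).2.2
    · simpa using h
    · simpa using h.trans_lt hab

theorem not_holds_of_le (hab : a < b) {p : ℚ} (h0 : s 0 = State.init a p)
    (hs : ∀ n, s (n + 1) = (s n).next a b (d n)) {n : ℕ} (h : b ≤ (s n).2.1) :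
    (s n).2.2 = false := by
  cases n with
  | zero => rw [h0] at h ⊢; simpa [State.init] using hab.trans_le h
  | succ n =>
    rw [hs] at h ⊢
    simp only [State.next] at h ⊢
    cases (s n).2.2
    · simpa using hab.trans_le h
    · simpa using h

/-- The upcrossing strategy makes the capital tend to infinity if the price oscillates. -/
theorem tendsto_capital (ha : 0 ≤ a) (hab : a < b) {p : ℚ} (h0 : s 0 = State.init a p)
    (hs : ∀ n, s (n + 1) = (s n).next a b (d n)) (hp : ∀ n, 0 ≤ (s n).2.1)
    (hlow : ∃ᶠ n in atTop, (s n).2.1 ≤ a) (hhigh : ∃ᶠ n in atTop, b ≤ (s n).2.1) :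
    Tendsto (fun n => (s n).1) atTop atTop := by
  have hmono := monotone_bank hab.le hs
  have key : ∀ k : ℕ, ∃ n, k * (b - a) ≤ (s n).bank a := by
    intro k
    induction k with
    | zero =>
      refine ⟨0, ?_⟩
      have := bank_init (a := a) p
      rw [h0]
      simpa using ha.trans this
    | succ k ih =>
      obtain ⟨n, hn⟩ := ih
      -- One more upcrossing: she holds a share at the low time `m` and none at the later high time
      -- `l`, so the bank gains `b - a`.
      obtain ⟨m, hm, hma⟩ := frequently_atTop.1 hlow n
      obtain ⟨l, hl, hlb⟩ := frequently_atTop.1 hhigh m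
      refine ⟨l, ?_⟩
      have h1 := bank_add_le hab.le hs hl (holds_of_le hab h0 hs hma)
      have h2 := hmono hm
      simp only [not_holds_of_le hab h0 hs hlb, cond_false] at h1 h2
      push_cast
      linarith
  refine tendsto_atTop.2 fun C => ?_
  obtain ⟨k, hk⟩ := exists_nat_gt ((C + a) / (b - a))
  rw [div_lt_iff₀ (by linarith)] at hk
  obtain ⟨n, hn⟩ := key k
  filter_upwards [eventually_ge_atTop n] with m hm
  have h1 := hmono hm
  have h2 := bank_sub_le_capital ha (s m) (hp m)
  simp only at h1
  linarith

end Strategy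

/-! ### The gambler's martingale -/

/-- The martingale difference `A_{n+1} - 𝔼_n(A_{n+1})` where `A_n` is determined by the first `K_n`
bits. -/
def increment (A : ℕ → Space → ℚ) (K : ℕ → ℕ) (n : ℕ) (ω : Space) : ℚ :=
  A (n + 1) ω -
    (∑ t ∈ Finset.range (2 ^ K (n + 1)), A (n + 1) (concat n ω (toSpace t.testBit))) /
      (2 ^ K (n + 1) : ℕ)

/-- The states of the gambler trading in the martingale `A_0 + 1 + ∑ (A_{i+1} - 𝔼_i(A_{i+1}))`. -/
def process (A : ℕ → Space → ℚ) (K : ℕ → ℕ) (a b : ℚ) (ω : Space) : ℕ → State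
  | 0 => State.init a (A 0 ω + 1)
  | n + 1 => (process A K a b ω n).next a b (increment A K n ω)

/-- The pairing function is monotone in its first argument, so each bit of the concatenation that
comes from `ξ` has in `ξ` an index no larger; the same bound `K` works. -/
theorem DependsOnBits.comp_concat {β : Type*} {K : ℕ} {f : Space → β} (hf : DependsOnBits K f)
    (n : ℕ) (ω : Space) : DependsOnBits K fun ξ => f (concat n ω ξ) := by
  intro ξ ξ' h
  refine hf _ _ fun i hi => ?_
  by_cases hn : i.unpair.1 < n
  · simp [directSum, concat, hn]
  · have hle : Nat.pair (i.unpair.1 - n) i.unpair.2 ≤ i := by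
      rcases Nat.eq_zero_or_pos n with rfl | h0
      · simp
      · have := Nat.pair_lt_pair_left i.unpair.2 (show i.unpair.1 - n < i.unpair.1 by omega)
        rw [Nat.pair_unpair] at this
        exact this.le
    have := h _ (hle.trans_lt hi)
    simpa [directSum, concat, hn] using this

section GamblerProcess

variable {A : ℕ → Space → ℚ} {K : ℕ → ℕ} {a b : ℚ}

theorem condExpectation_of_dependsOnBits {k n : ℕ} {f : Space → ℚ} (hf : DependsOnBits k f)
    (ω : Space) : condExpectation n (fun ω => (f ω : ℝ)) ω =
      (((∑ t ∈ Finset.range (2 ^ k), f (concat n ω (toSpace t.testBit))) / (2 ^ k : ℕ) : ℚ) : ℝ) := by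
  have h : DependsOnBits k fun ξ => (f (concat n ω ξ) : ℝ) := fun ξ ξ' h =>
    congrArg _ (hf.comp_concat n ω ξ ξ' h)
  rw [condExpectation, h.integral_eq]
  push_cast
  rfl

theorem increment_eq_of_agreeBelow
    (hA : ∀ n ω ω', AgreeBelow n ω ω' → A n ω = A n ω') {n : ℕ} {ω ω' : Space}
    (h : AgreeBelow (n + 1) ω ω') : increment A K n ω = increment A K n ω' := by
  have h' : AgreeBelow n ω ω' := fun i hi => h i (by omega)
  simp only [increment, hA _ _ _ h, h'.concat_eq]

theorem process_eq_of_agreeBelow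
    (hA : ∀ n ω ω', AgreeBelow n ω ω' → A n ω = A n ω') {n : ℕ} {ω ω' : Space}
    (h : AgreeBelow n ω ω') : process A K a b ω n = process A K a b ω' n := by
  induction n with
  | zero => simp only [process, hA 0 _ _ h]
  | succ n ih =>
    simp only [process, ih fun i hi => h i (by omega), increment_eq_of_agreeBelow hA h]

/-- The subtracted average is the conditional expectation of `A (n + 1)` and depends only on the
first `n` sequences. -/
theorem condExpectation_increment (hK : ∀ n, DependsOnBits (K n) (A n)) (n : ℕ) (ω : Space) :
    ∫ ξ, (increment A K n (concat n ω ξ) : ℝ) ∂P = 0 := by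
  have h := condExpectation_of_dependsOnBits (hK (n + 1)) (n := n) ω
  have hc : ∀ ξ, increment A K n (concat n ω ξ) = A (n + 1) (concat n ω ξ) -
      (∑ t ∈ Finset.range (2 ^ K (n + 1)), A (n + 1) (concat n ω (toSpace t.testBit))) /
      (2 ^ K (n + 1) : ℕ) := fun ξ => by
    simp only [increment, (agreeBelow_concat n ω ξ).concat_eq]
  simp only [hc, Rat.cast_sub]
  rw [integral_sub, ← h]
  · simp [condExpectation]
  · have : DependsOnBits (K (n + 1)) fun ω => (A (n + 1) ω : ℝ) := fun ω ω' h =>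
      congrArg _ (hK (n + 1) ω ω' h)
    exact integrable_of_continuous (this.comp_concat n ω).continuous
  · exact integrable_const _

/-- The total wealth of the gambler, together with the price. -/
def wealth (A : ℕ → Space → ℚ) (K : ℕ → ℕ) (a b : ℚ) (n : ℕ) (ω : Space) : ℚ :=
  (process A K a b ω n).1 + (process A K a b ω n).2.1

/-- The price always moves by the increment, and the capital moves with it if a share is held. The
factor is known at time `n`, which gives the martingale property. -/
theorem wealth_succ (n : ℕ) (ω : Space) : wealth A K a b (n + 1) ω = wealth A K a b n ω +
    (bif (process A K a b ω n).2.2 then 2 else 1) * increment A K n ω := by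
  simp only [wealth, process, State.next]
  cases (process A K a b ω n).2.2 <;> simp <;> ring

theorem isMartingale_wealth (hK : ∀ n, DependsOnBits (K n) (A n))
    (hA : ∀ n ω ω', AgreeBelow n ω ω' → A n ω = A n ω')
    (hW : ∀ n, Continuous fun ω => (wealth A K a b n ω : ℝ)) :
    IsMartingale fun n ω => (wealth A K a b n ω : ℝ) := by
  refine isMartingale_of_step hW (fun n ω ω' h => ?_) fun n ω => ?_
  · simp only [wealth, process_eq_of_agreeBelow hA h]
  · have hp : ∀ ξ, process A K a b (concat n ω ξ) n = process A K a b ω n := fun ξ =>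
      process_eq_of_agreeBelow hA (agreeBelow_concat n ω ξ)
    have hw : ∀ ξ, wealth A K a b n (concat n ω ξ) = wealth A K a b n ω := fun ξ => by
      simp only [wealth, hp]
    set c : ℚ := bif (process A K a b ω n).2.2 then 2 else 1 with hc
    have hc0 : c ≠ 0 := by rw [hc]; cases (process A K a b ω n).2.2 <;> simp
    -- Since the factor is nonzero, the increment can be expressed through the wealth, whose
    -- integrability comes from continuity.
    have hinc : ∀ ξ, (increment A K n (concat n ω ξ) : ℝ) =
        ((wealth A K a b (n + 1) (concat n ω ξ) : ℝ) - wealth A K a b n ω) / c := fun ξ => by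
      rw [wealth_succ, hw, hp, ← hc]
      push_cast
      have : (c : ℝ) ≠ 0 := by exact_mod_cast hc0
      field_simp
      ring
    have h0 := condExpectation_increment hK n ω
    simp only [hinc] at h0
    have hi : Integrable (fun ξ => (wealth A K a b (n + 1) (concat n ω ξ) : ℝ)) P :=
      integrable_of_continuous ((hW (n + 1)).comp (continuous_concat_right n ω))
    rw [integral_div, integral_sub hi (integrable_const _)] at h0
    have : (c : ℝ) ≠ 0 := by exact_mod_cast hc0
    simp only [div_eq_zero_iff, this, or_false, integral_const, probReal_univ, one_smul] at h0
    rw [condExpectation]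
    linarith

end GamblerProcess

/-! ### Computability of the gambler's martingale -/

/-- A computable rational-valued adapted process: `A_n(ω)` is computed by `c` from `n` and the first
`K_n` bits of `ω_{<n}`. -/
structure IsComputedBy (A : ℕ → Space → ℚ) (K : ℕ → ℕ) (c : List Bool → ℕ → ℕ) : Prop where
  computable_modulus : Computable K
  computable_code : Computable₂ c
  eq_code : ∀ n ω, A n ω = q (c (initialBits (directSum (truncate n ω)) (K n)) n)

/-- Codes of states. -/
def State.decode (s : ℕ × ℕ × Bool) : State := (q s.1, q s.2.1, s.2.2)

/-- `State.init` on codes. -/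
def initCode (a p : ℕ) : ℕ × ℕ × Bool := (a, p, qle p a)

/-- `State.next` on codes. -/
def nextCode (a b : ℕ) (s : ℕ × ℕ × Bool) (d : ℕ) : ℕ × ℕ × Bool :=
  (bif s.2.2 then qadd s.1 d else s.1, qadd s.2.1 d,
    bif s.2.2 then !qle b (qadd s.2.1 d) else qle (qadd s.2.1 d) a)

theorem decode_initCode (a p : ℕ) : State.decode (initCode a p) = State.init (q a) (q p) := by
  simp [State.decode, initCode, State.init, qle_eq]

theorem decode_nextCode (a b : ℕ) (s : ℕ × ℕ × Bool) (d : ℕ) :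
    State.decode (nextCode a b s d) = (State.decode s).next (q a) (q b) (q d) := by
  obtain ⟨T, N, h⟩ := s
  cases h <;> simp [State.decode, nextCode, State.next, qle_eq, q_qadd] <;> congr

/-- `∑_{t < m} A_{n+1}(ω_{<n} ⌢ t)` on codes. -/
def sumCode (K : ℕ → ℕ) (c : List Bool → ℕ → ℕ) (σ : List Bool) (n m : ℕ) : ℕ :=
  Nat.rec 0 (fun t acc => qadd acc
    (c (restrictBits (K (n + 1)) (n + 1) (mergeBits (K (n + 1)) n σ t)) (n + 1))) m

/-- `increment` on codes. -/
def incrementCode (K : ℕ → ℕ) (c : List Bool → ℕ → ℕ) (σ : List Bool) (n : ℕ) : ℕ :=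
  qsub (c (restrictBits (K (n + 1)) (n + 1) σ) (n + 1))
    (qdivNat (sumCode K c σ n (2 ^ K (n + 1))) (2 ^ K (n + 1)))

/-- `process` on codes. -/
def processCode (K : ℕ → ℕ) (c : List Bool → ℕ → ℕ) (a b e : ℕ) (σ : List Bool) (n : ℕ) :
    ℕ × ℕ × Bool :=
  Nat.rec (initCode a (qadd (c (restrictBits (K 0) 0 σ) 0) e))
    (fun m s => nextCode a b s (incrementCode K c σ m)) n

/-- A number of bits sufficient for computing the first `n` steps. -/
def totalModulus (K : ℕ → ℕ) (n : ℕ) : ℕ := Nat.rec (K 0) (fun m acc => acc + K (m + 1)) n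

theorem le_totalModulus (K : ℕ → ℕ) {m n : ℕ} (h : m ≤ n) : K m ≤ totalModulus K n := by
  induction n, h using Nat.le_induction with
  | base => cases m <;> simp [totalModulus]
  | succ n h ih => exact ih.trans (Nat.le_add_right _ _)

theorem computable_totalModulus {K : ℕ → ℕ} (hK : Computable K) :
    Computable (totalModulus K) := by
  have h : Computable₂ fun (_ : ℕ) (s : ℕ × ℕ) => s.2 + K (s.1 + 1) :=
    Computable₂.mk (Primrec.nat_add.to_comp.comp (Computable.snd.comp Computable.snd)
      (hK.comp (Computable.succ.comp (Computable.fst.comp Computable.snd))))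
  exact Computable.nat_rec Computable.id (Computable.const (K 0)) h

theorem computable_initCode (a : ℕ) : Computable (initCode a) :=
  (Computable.const a).pair (Computable.id.pair
    (primrec_qle.to_comp.comp Computable.id (Computable.const a)))

theorem primrec_nextCode (a b : ℕ) : Primrec₂ (nextCode a b) := by
  have hT : Primrec fun p : (ℕ × ℕ × Bool) × ℕ => p.1.1 := Primrec.fst.comp Primrec.fst
  have hN : Primrec fun p : (ℕ × ℕ × Bool) × ℕ => p.1.2.1 :=
    Primrec.fst.comp (Primrec.snd.comp Primrec.fst)
  have hh : Primrec fun p : (ℕ × ℕ × Bool) × ℕ => p.1.2.2 :=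
    Primrec.snd.comp (Primrec.snd.comp Primrec.fst)
  have hN' : Primrec fun p : (ℕ × ℕ × Bool) × ℕ => qadd p.1.2.1 p.2 :=
    primrec_qadd.comp hN Primrec.snd
  exact (Primrec.cond hh (primrec_qadd.comp hT Primrec.snd) hT).pair (hN'.pair
    (Primrec.cond hh (Primrec.not.comp (primrec_qle.comp (Primrec.const b) hN'))
      (primrec_qle.comp hN' (Primrec.const a))))

section

variable {A : ℕ → Space → ℚ} {K : ℕ → ℕ} {c : List Bool → ℕ → ℕ}

theorem computable_restrictBits {α : Type*} [Primcodable α] {k n : α → ℕ} {σ : α → List Bool}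
    (hk : Computable k) (hn : Computable n) (hσ : Computable σ) :
    Computable fun x => restrictBits (k x) (n x) (σ x) :=
  (primrec_restrictBits (Primrec.fst (α := ℕ) (β := ℕ × List Bool))
    (Primrec.fst.comp Primrec.snd) (Primrec.snd.comp Primrec.snd)).to_comp.comp
    (hk.pair (hn.pair hσ))

theorem computable_mergeBits {α : Type*} [Primcodable α] {k n t : α → ℕ} {σ : α → List Bool}
    (hk : Computable k) (hn : Computable n) (hσ : Computable σ) (ht : Computable t) :
    Computable fun x => mergeBits (k x) (n x) (σ x) (t x) :=
  (primrec_mergeBits (Primrec.fst (α := ℕ) (β := ℕ × List Bool × ℕ))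
    (Primrec.fst.comp Primrec.snd) (Primrec.fst.comp (Primrec.snd.comp Primrec.snd))
    (Primrec.snd.comp (Primrec.snd.comp Primrec.snd))).to_comp.comp
    (hk.pair (hn.pair (hσ.pair ht)))

theorem computable_incrementCode (hK : Computable K) (hc : Computable₂ c) :
    Computable₂ (incrementCode K c) := by
  have hn : Computable fun p : List Bool × ℕ => p.2 + 1 := Computable.succ.comp Computable.snd
  have hKn : Computable fun p : List Bool × ℕ => K (p.2 + 1) := hK.comp hn
  have hpow : Computable fun p : List Bool × ℕ => 2 ^ K (p.2 + 1) :=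
    primrec_two_pow.to_comp.comp hKn
  have hterm : Computable₂ fun (p : List Bool × ℕ) (s : ℕ × ℕ) => qadd s.2
      (c (restrictBits (K (p.2 + 1)) (p.2 + 1) (mergeBits (K (p.2 + 1)) p.2 p.1 s.1))
        (p.2 + 1)) :=
    Computable₂.mk (primrec_qadd.to_comp.comp (Computable.snd.comp Computable.snd)
      (hc.comp (computable_restrictBits (hKn.comp Computable.fst) (hn.comp Computable.fst)
        (computable_mergeBits (hKn.comp Computable.fst) (Computable.snd.comp Computable.fst)
          (Computable.fst.comp Computable.fst) (Computable.fst.comp Computable.snd)))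
        (hn.comp Computable.fst)))
  have hsum : Computable fun p : List Bool × ℕ => sumCode K c p.1 p.2 (2 ^ K (p.2 + 1)) :=
    Computable.nat_rec hpow (Computable.const 0) hterm
  exact primrec_qsub.to_comp.comp (hc.comp (computable_restrictBits hKn hn Computable.fst) hn)
    (primrec_qdivNat.to_comp.comp hsum hpow)

theorem computable_processCode (hK : Computable K) (hc : Computable₂ c) (a b e : ℕ) :
    Computable₂ (processCode K c a b e) := by
  have h0 : Computable fun p : List Bool × ℕ =>
      initCode a (qadd (c (restrictBits (K 0) 0 p.1) 0) e) :=
    (computable_initCode a).comp (primrec_qadd.to_comp.comp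
      (hc.comp (computable_restrictBits (Computable.const _) (Computable.const 0) Computable.fst)
        (Computable.const 0)) (Computable.const e))
  have h1 : Computable₂ fun (p : List Bool × ℕ) (s : ℕ × ℕ × ℕ × Bool) =>
      nextCode a b s.2 (incrementCode K c p.1 s.1) :=
    Computable₂.mk ((primrec_nextCode a b).to_comp.comp (Computable.snd.comp Computable.snd)
      ((computable_incrementCode hK hc).comp (Computable.fst.comp Computable.fst)
        (Computable.fst.comp Computable.snd)))
  exact (Computable.nat_rec Computable.snd h0 h1).of_eq fun p => rfl

namespace IsComputedBy

theorem eq_of_agreeBelow (h : IsComputedBy A K c) (n : ℕ) (ω ω' : Space)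
    (hω : AgreeBelow n ω ω') : A n ω = A n ω' := by
  rw [h.eq_code, h.eq_code, truncate, truncate, hω.concat_eq]

theorem eq_code_restrictBits (h : IsComputedBy A K c) {n L : ℕ} (hL : K n ≤ L) (ω : Space) :
    q (c (restrictBits (K n) n (initialBits (directSum ω) L)) n) = A n ω := by
  rw [restrictBits_initialBits hL, h.eq_code]

theorem dependsOnBits (h : IsComputedBy A K c) (n : ℕ) : DependsOnBits (K n) (A n) := by
  intro ω ω' hω
  rw [← h.eq_code_restrictBits le_rfl, ← h.eq_code_restrictBits le_rfl,
    initialBits_eq_iff.2 hω]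

theorem q_incrementCode (h : IsComputedBy A K c) {n L : ℕ} (hL : K (n + 1) ≤ L) (ω : Space) :
    q (incrementCode K c (initialBits (directSum ω) L) n) = increment A K n ω := by
  have hsum : ∀ m, q (sumCode K c (initialBits (directSum ω) L) n m) =
      ∑ t ∈ Finset.range m, A (n + 1) (concat n ω (toSpace t.testBit)) := by
    intro m
    induction m with
    | zero => exact q_zero
    | succ m ih =>
      rw [Finset.sum_range_succ, ← ih, ← h.eq_code_restrictBits le_rfl, ← q_qadd,
        ← mergeBits_initialBits hL]
      rfl
  rw [incrementCode, q_qsub, q_qdivNat _ (by positivity), hsum, h.eq_code_restrictBits hL]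
  rfl

theorem decode_processCode (h : IsComputedBy A K c) (a b : ℕ) {e : ℕ} (he : q e = 1) {n L : ℕ}
    (hL : totalModulus K n ≤ L) (ω : Space) :
    State.decode (processCode K c a b e (initialBits (directSum ω) L) n) =
      process A K (q a) (q b) ω n := by
  induction n with
  | zero =>
    refine (decode_initCode _ _).trans ?_
    rw [q_qadd, h.eq_code_restrictBits ((le_totalModulus K le_rfl).trans hL), he]
    rfl
  | succ n ih =>
    refine (decode_nextCode _ _ _ _).trans ?_
    refine (congrArg (State.next _ _ · _) (ih ((Nat.le_add_right _ _).trans hL))).trans ?_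
    rw [h.q_incrementCode ((le_totalModulus K le_rfl).trans hL)]
    rfl

/-- The wealth of the gambler is a computable rational-valued martingale. -/
theorem isComputableRationalMartingale_wealth (h : IsComputedBy A K c) (a b : ℚ) :
    IsComputableRationalMartingale fun n ω => (wealth A K a b n ω : ℝ) := by
  obtain ⟨a, rfl⟩ := q_surjective a
  obtain ⟨b, rfl⟩ := q_surjective b
  obtain ⟨e, he⟩ := q_surjective 1
  have hcode : ∀ n ω, wealth A K (q a) (q b) n ω = q (qadd
      (processCode K c a b e (initialBits (directSum ω) (totalModulus K n)) n).1
      (processCode K c a b e (initialBits (directSum ω) (totalModulus K n)) n).2.1) := by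
    intro n ω
    rw [q_qadd, wealth, ← h.decode_processCode a b he le_rfl]
    rfl
  have hprocess := computable_processCode h.computable_modulus h.computable_code a b e
  have hmod := computable_totalModulus h.computable_modulus
  -- The algorithm waits for `totalModulus K n` bits and then discards any further ones, so all its
  -- answers coincide.
  refine ⟨isMartingale_wealth h.dependsOnBits h.eq_of_agreeBelow fun n => ?_,
    fun ω n => qadd
      (processCode K c a b e (initialBits (directSum ω) (totalModulus K n)) n).1
      (processCode K c a b e (initialBits (directSum ω) (totalModulus K n)) n).2.1,
    ⟨fun σ n => bif decide (totalModulus K n ≤ σ.length) then some (qadd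
      (processCode K c a b e (σ.take (totalModulus K n)) n).1
      (processCode K c a b e (σ.take (totalModulus K n)) n).2.1) else none, ?_, ?_⟩, ?_⟩
  · have : DependsOnBits (totalModulus K n) fun ω => (wealth A K (q a) (q b) n ω : ℝ) := by
      intro ω ω' hω
      simp only [hcode, initialBits_eq_iff.2 hω]
    exact this.continuous
  · have hp : Computable fun p : List Bool × ℕ =>
        processCode K c a b e (p.1.take (totalModulus K p.2)) p.2 :=
      hprocess.comp (Primrec.list_take.to_comp.comp (hmod.comp Computable.snd) Computable.fst)
        Computable.snd
    exact Computable.cond (Primrec.nat_le.decide.to_comp.comp (hmod.comp Computable.snd)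
      (Computable.list_length.comp Computable.fst))
      (Computable.option_some.comp (primrec_qadd.to_comp.comp (Computable.fst.comp hp)
        (Computable.fst.comp (Computable.snd.comp hp)))) (Computable.const none)
  · refine fun ω n => ⟨⟨totalModulus K n, ?_⟩, fun k y hy => ?_⟩
    · simp [take_initialBits]
    · by_cases hk : totalModulus K n ≤ k
      · simp only [length_initialBits, hk, decide_true, cond_true, take_initialBits _ hk,
          Option.some.injEq] at hy
        exact hy.symm
      · simp [hk] at hy
  · intro n ω
    rw [← hcode]
    simp only [wealth, process_eq_of_agreeBelow h.eq_of_agreeBelow (agreeBelow_truncate n ω)]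

end IsComputedBy

end

/-! ### Approximation of computable martingales -/

theorem IsCauchyName.abs_sub_le {p : ℕ → ℕ} {x : ℝ} (h : IsCauchyName p x) (m : ℕ) :
    |x - q (p m)| ≤ (2 : ℝ)⁻¹ ^ m :=
  le_of_tendsto ((h.2.sub_const _).abs) (eventually_atTop.2 ⟨m, fun n hn => h.1 m n hn⟩)

theorem isCauchyName_const {i : ℕ} {x : ℝ} (h : x = q i) : IsCauchyName (fun _ => i) x :=
  ⟨fun m n _ => by simp, h ▸ tendsto_const_nhds⟩

/-- A computable functional has a computable modulus of continuity. -/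
theorem ComputableFunctional.exists_code {X : Type} [Primcodable X] {F : Space → X → ℕ}
    (hF : ComputableFunctional F) : ∃ (K : X → ℕ) (c : List Bool → X → ℕ), Computable K ∧
      Computable₂ c ∧ ∀ ω x, F ω x = c (initialBits (directSum ω) (K x)) x := by
  obtain ⟨φ, hφ, h⟩ := hF
  have hbound : ∀ x, ∃ K, answersBelow φ K x = true := fun x =>
    exists_answersBelow (f := fun α => F (toSpace α) x) fun α => by
      simpa using (h (toSpace α) x).1
  obtain ⟨K, hK, hKφ⟩ := exists_computable_modulus hφ hbound
  -- The default value is never used on prefixes of length `K x`, where `φ` has answered.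
  refine ⟨K, fun σ x => (answer φ σ x).getD 0, hK,
    Computable.option_getD (computable_answer hφ) (Computable.const 0), fun ω x => ?_⟩
  simp [answer_eq_some_of_answersBelow (h ω x).2 (hKφ x)]

/-- The terms of the Cauchy names are continuous functions of the point, and they converge uniformly
at the rate `2^{-k}`. -/
theorem ComputablyAdapted.continuous {M : ℕ → Space → ℝ} (hM : ComputablyAdapted M) (n : ℕ) :
    Continuous (M n) := by
  obtain ⟨F, hF, hMF⟩ := hM
  obtain ⟨K, c, -, -, hc⟩ := hF.exists_code
  have hcont : ∀ k, Continuous fun ω => (q (F (truncate n ω) (n, k)) : ℝ) := fun k => by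
    have : DependsOnBits (K (n, k)) fun ω => (q (F ω (n, k)) : ℝ) := fun ω ω' h => by
      simp only [hc, initialBits_eq_iff.2 h]
    exact this.continuous.comp (continuous_truncate n)
  have hunif : TendstoUniformly (fun k ω => (q (F (truncate n ω) (n, k)) : ℝ)) (M n) atTop := by
    rw [Metric.tendstoUniformly_iff]
    intro ε hε
    have h0 := tendsto_pow_atTop_nhds_zero_of_lt_one (r := (2 : ℝ)⁻¹) (by norm_num) (by norm_num)
    filter_upwards [h0.eventually (gt_mem_nhds hε)] with k hk ω
    exact ((hMF n ω).abs_sub_le k).trans_lt hk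
  exact hunif.continuous (.of_forall hcont)

theorem ComputablyAdapted.exists_approx {M : ℕ → Space → ℝ} (hM : ComputablyAdapted M) :
    ∃ A K c, IsComputedBy A K c ∧ ∀ n ω, |M n ω - A n ω| ≤ (2 : ℝ)⁻¹ ^ (n + 3) := by
  obtain ⟨F, hF, hMF⟩ := hM
  obtain ⟨K, c, hK, hcc, hc⟩ := hF.exists_code
  have hpair : Computable fun n : ℕ => (n, n + 3) :=
    Computable.id.pair (Primrec.nat_add.to_comp.comp Computable.id (Computable.const 3))
  refine ⟨fun n ω => q (F (truncate n ω) (n, n + 3)), fun n => K (n, n + 3),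
    fun σ n => c σ (n, n + 3), ⟨hK.comp hpair,
      hcc.comp Computable.fst (hpair.comp Computable.snd), fun n ω => ?_⟩,
    fun n ω => (hMF n ω).abs_sub_le (n + 3)⟩
  rw [hc]

/-! ### The price follows the given martingale -/

section Price

variable {A : ℕ → Space → ℚ} {K : ℕ → ℕ} {c : List Bool → ℕ → ℕ} {M : ℕ → Space → ℝ} {a b : ℚ}

/-- As `M n` is the conditional expectation of `M (n + 1)`, replacing `M (n + 1)` by `A (n + 1)`
costs at most `2^{-(n+4)}` in each of the two terms. -/
theorem abs_increment_sub_le (hA : IsComputedBy A K c) (hM : IsMartingale M)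
    (hMc : ∀ n, Continuous (M n)) (hAM : ∀ n ω, |M n ω - A n ω| ≤ (2 : ℝ)⁻¹ ^ (n + 3)) (n : ℕ)
    (ω : Space) : |M (n + 1) ω - M n ω - increment A K n ω| ≤ (2 : ℝ)⁻¹ ^ (n + 3) := by
  have hAc : Continuous fun ω => (A (n + 1) ω : ℝ) := by
    have : DependsOnBits (K (n + 1)) fun ω => (A (n + 1) ω : ℝ) := fun ω ω' h =>
      congrArg _ (hA.dependsOnBits (n + 1) ω ω' h)
    exact this.continuous
  have h1 := hAM (n + 1) ω
  have h2 : |M n ω - condExpectation n (fun ω => (A (n + 1) ω : ℝ)) ω| ≤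
      (2 : ℝ)⁻¹ ^ (n + 1 + 3) := by
    have i1 : Integrable (fun ξ => M (n + 1) (concat n ω ξ)) P :=
      integrable_of_continuous ((hMc _).comp (continuous_concat_right n ω))
    have i2 : Integrable (fun ξ => (A (n + 1) (concat n ω ξ) : ℝ)) P :=
      integrable_of_continuous (hAc.comp (continuous_concat_right n ω))
    rw [← hM.condExpectation_eq_of_continuous hMc n.le_succ, condExpectation, condExpectation,
      ← integral_sub i1 i2]
    have h := norm_integral_le_of_norm_le_const (μ := P)
      (f := fun ξ => M (n + 1) (concat n ω ξ) - A (n + 1) (concat n ω ξ))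
      (.of_forall fun ξ => hAM (n + 1) (concat n ω ξ))
    simpa using h
  rw [condExpectation_of_dependsOnBits (hA.dependsOnBits (n + 1))] at h2
  have h3 : (2 : ℝ)⁻¹ ^ (n + 3) = (2 : ℝ)⁻¹ ^ (n + 1 + 3) + (2 : ℝ)⁻¹ ^ (n + 1 + 3) := by ring
  rw [increment, Rat.cast_sub, h3]
  rw [abs_le] at h1 h2 ⊢
  constructor <;> linarith

/-- The price in the gambler's martingale. -/
def price (A : ℕ → Space → ℚ) (K : ℕ → ℕ) (a b : ℚ) (n : ℕ) (ω : Space) : ℚ :=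
  (process A K a b ω n).2.1

/-- The initial error is at most `1/8` and step `n` adds at most `2^{-(n+3)}`, exactly the growth of
the bound. As the bound stays below `1/2`, the shift by `1` keeps the price nonnegative. -/
theorem abs_price_sub_le (hA : IsComputedBy A K c) (hM : IsMartingale M)
    (hMc : ∀ n, Continuous (M n)) (hAM : ∀ n ω, |M n ω - A n ω| ≤ (2 : ℝ)⁻¹ ^ (n + 3)) (n : ℕ)
    (ω : Space) : |price A K a b n ω - M n ω - 1| ≤ 2⁻¹ - (2 : ℝ)⁻¹ ^ (n + 2) := by
  induction n with
  | zero =>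
    have := hAM 0 ω
    rw [abs_le] at this ⊢
    simp only [price, process, State.init]
    push_cast
    norm_num at this ⊢
    constructor <;> linarith
  | succ n ih =>
    have h1 := abs_increment_sub_le hA hM hMc hAM n ω
    have h2 : (price A K a b (n + 1) ω : ℝ) = price A K a b n ω + increment A K n ω := by
      simp [price, process, State.next]
    have h3 : (2 : ℝ)⁻¹ ^ (n + 2) = (2 : ℝ)⁻¹ ^ (n + 3) + (2 : ℝ)⁻¹ ^ (n + 3) := by ring
    rw [h2, show n + 1 + 2 = n + 3 by ring]
    rw [abs_le] at h1 ih ⊢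
    constructor <;> linarith

theorem price_nonneg (hA : IsComputedBy A K c) (hM : IsMartingale M)
    (hMc : ∀ n, Continuous (M n)) (hAM : ∀ n ω, |M n ω - A n ω| ≤ (2 : ℝ)⁻¹ ^ (n + 3))
    (hM0 : Nonneg M) (n : ℕ) (ω : Space) : 0 ≤ price A K a b n ω := by
  have h := (abs_le.1 (abs_price_sub_le (a := a) (b := b) hA hM hMc hAM n ω)).1
  have h0 := hM0 n ω
  have h1 : (0 : ℝ) < (2 : ℝ)⁻¹ ^ (n + 2) := by positivity
  have : (0 : ℝ) ≤ price A K a b n ω := by linarith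
  exact_mod_cast this

theorem convergesAt_of_price (hA : IsComputedBy A K c) (hM : IsMartingale M)
    (hMc : ∀ n, Continuous (M n)) (hAM : ∀ n ω, |M n ω - A n ω| ≤ (2 : ℝ)⁻¹ ^ (n + 3))
    {ω : Space} (h : ∃ l : ℝ, Tendsto (fun n => (price A K a b n ω : ℝ)) atTop (𝓝 l)) :
    ConvergesAt M ω := by
  obtain ⟨l, hl⟩ := h
  have hcauchy : CauchySeq fun n => M n ω - price A K a b n ω := by
    refine cauchySeq_of_le_geometric (2 : ℝ)⁻¹ 1 (by norm_num) fun n => ?_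
    have h1 := abs_increment_sub_le hA hM hMc hAM n ω
    have h2 : (price A K a b (n + 1) ω : ℝ) = price A K a b n ω + increment A K n ω := by
      simp [price, process, State.next]
    rw [dist_comm, Real.dist_eq, h2, one_mul]
    have h3 : (2 : ℝ)⁻¹ ^ (n + 3) ≤ (2 : ℝ)⁻¹ ^ n :=
      pow_le_pow_of_le_one (by norm_num) (by norm_num) (by omega)
    refine le_trans (le_of_eq ?_) (h1.trans h3)
    congr 1
    ring
  obtain ⟨l', hl'⟩ := cauchySeq_tendsto_of_complete hcauchy
  exact ⟨l' + l, by simpa using hl'.add hl⟩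

end Price

/-! ### Divergence and the equivalences -/

/-- A nonnegative sequence that diverges tends to infinity or oscillates. -/
theorem tendsto_atTop_or_oscillates {u : ℕ → ℝ} (h0 : ∀ n, 0 ≤ u n)
    (h : ¬ ∃ l : ℝ, Tendsto u atTop (𝓝 l)) : Tendsto u atTop atTop ∨
      ∃ a b : ℚ, 0 ≤ a ∧ a < b ∧ (∃ᶠ n in atTop, u n ≤ a) ∧ ∃ᶠ n in atTop, (b : ℝ) ≤ u n := by
  -- In the extended reals both limits exist without boundedness assumptions, and equality of the
  -- two gives convergence there.
  set v : ℕ → EReal := fun n => u n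
  rcases (liminf_le_limsup : liminf v atTop ≤ limsup v atTop).eq_or_lt with heq | hlt
  · left
    have ht := tendsto_of_liminf_eq_limsup heq rfl
    generalize limsup v atTop = L at ht
    induction L with
    | bot =>
      have := ge_of_tendsto' ht fun n => (EReal.coe_nonneg.2 (h0 n) : (0 : EReal) ≤ v n)
      simp at this
    | coe l => exact absurd ⟨l, EReal.tendsto_coe.1 ht⟩ h
    | top => exact EReal.tendsto_coe_nhds_top_iff.1 ht
  · right
    obtain ⟨b, hb, hb'⟩ := EReal.lt_iff_exists_rat_btwn.1 hlt
    obtain ⟨a, ha, hab⟩ := EReal.lt_iff_exists_rat_btwn.1 hb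
    have hlow : ∃ᶠ n in atTop, u n ≤ a := (frequently_lt_of_liminf_lt (by isBoundedDefault) ha).mono
      fun n hn => (EReal.coe_lt_coe_iff.1 hn).le
    obtain ⟨n, hn⟩ := hlow.exists
    refine ⟨a, b, by exact_mod_cast (h0 n).trans hn, by exact_mod_cast hab, hlow, ?_⟩
    exact (frequently_lt_of_lt_limsup (by isBoundedDefault) hb').mono
      fun n hn => (EReal.coe_lt_coe_iff.1 hn).le

/-- If a nonnegative computable martingale diverges at `ω`, then a nonnegative computable
rational-valued martingale tends to infinity at `ω`. -/
theorem exists_rationalMartingale_tendsto {M : ℕ → Space → ℝ} (hM : IsComputableMartingale M)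
    (hM0 : Nonneg M) {ω : Space} (hω : ¬ ConvergesAt M ω) :
    ∃ W : ℕ → Space → ℝ, IsComputableRationalMartingale W ∧ Nonneg W ∧
      Tendsto (fun n => W n ω) atTop atTop := by
  obtain ⟨hM, had⟩ := hM
  have hMc := had.continuous
  obtain ⟨A, K, c, hA, hAM⟩ := had.exists_approx
  have hp0 (a b : ℚ) (ω : Space) (n : ℕ) : 0 ≤ (process A K a b ω n).2.1 :=
    price_nonneg hA hM hMc hAM hM0 n ω
  have hc0 {a b : ℚ} (ha : 0 ≤ a) (hab : a ≤ b) (ω : Space) (n : ℕ) :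
      0 ≤ (process A K a b ω n).1 :=
    capital_nonneg ha hab rfl (fun _ => rfl) (hp0 a b ω) n
  have hW0 {a b : ℚ} (ha : 0 ≤ a) (hab : a ≤ b) : Nonneg fun n ω => (wealth A K a b n ω : ℝ) :=
    fun n ω => Rat.cast_nonneg.2 (add_nonneg (hc0 ha hab ω n) (hp0 a b ω n))
  -- The thresholds affect only the trading, so the behaviour of the price can be examined with the
  -- arbitrary pair `0`, `1` before the right thresholds are known.
  have hindep (a b : ℚ) (n : ℕ) : price A K a b n ω = price A K 0 1 n ω := by
    induction n with
    | zero => rfl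
    | succ n ih => exact congrArg (· + increment A K n ω) ih
  have hdiv : ¬ ∃ l : ℝ, Tendsto (fun n => (price A K 0 1 n ω : ℝ)) atTop (𝓝 l) := fun h =>
    hω (convergesAt_of_price hA hM hMc hAM h)
  rcases tendsto_atTop_or_oscillates (fun n => by exact_mod_cast hp0 0 1 ω n) hdiv with
    h | ⟨a, b, ha, hab, hlow, hhigh⟩
  -- The price alone tends to infinity, and the nonnegative capital does no harm.
  · refine ⟨_, hA.isComputableRationalMartingale_wealth 0 1, hW0 le_rfl zero_le_one,
      tendsto_atTop_mono (fun n => ?_) h⟩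
    exact_mod_cast le_add_of_nonneg_left (hc0 le_rfl zero_le_one ω n)
  · refine ⟨_, hA.isComputableRationalMartingale_wealth a b, hW0 ha hab.le, ?_⟩
    have ht : Tendsto (fun n => (process A K a b ω n).1) atTop atTop :=
      tendsto_capital ha hab rfl (fun _ => rfl) (hp0 a b ω)
        (hlow.mono fun n hn => by rw [← hindep a b] at hn; exact_mod_cast hn)
        (hhigh.mono fun n hn => by rw [← hindep a b] at hn; exact_mod_cast hn)
    refine tendsto_ratCast_atTop_iff.2 (tendsto_atTop_mono (fun n => ?_) ht)
    exact le_add_of_nonneg_right (hp0 a b ω n)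

theorem IsComputableRationalMartingale.isComputableMartingale {M : ℕ → Space → ℝ}
    (hM : IsComputableRationalMartingale M) : IsComputableMartingale M := by
  obtain ⟨hM, g, ⟨φ, hφ, h⟩, hMg⟩ := hM
  have hφ' : Computable₂ fun (σ : List Bool) (x : ℕ × ℕ) => φ σ x.1 :=
    Computable₂.mk (hφ.comp Computable.fst (Computable.fst.comp Computable.snd))
  refine ⟨hM, fun ω x => g ω x.1, ⟨_, hφ', fun ω x => ?_⟩, fun n ω => ?_⟩
  · exact h ω x.1
  · exact isCauchyName_const (i := g (truncate n ω) n) (hMg n ω)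

theorem not_convergesAt_of_limsup_eq_top {M : ℕ → Space → ℝ} {ω : Space}
    (h : limsup (fun n => (M n ω : EReal)) atTop = ⊤) : ¬ ConvergesAt M ω := by
  rintro ⟨l, hl⟩
  rw [(EReal.tendsto_coe.2 hl).limsup_eq] at h
  exact EReal.coe_ne_top l h

end DoobSeq

theorem mainTheorem9 (ω : DoobSeq.Space) :
    List.TFAE [
      ¬ DoobSeq.DoobRandom ω,
      ∃ M : ℕ → DoobSeq.Space → ℝ, DoobSeq.IsComputableRationalMartingale M ∧
        DoobSeq.Nonneg M ∧ ¬ DoobSeq.ConvergesAt M ω,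
      ∃ M : ℕ → DoobSeq.Space → ℝ, DoobSeq.IsComputableRationalMartingale M ∧
        DoobSeq.Nonneg M ∧
          Filter.limsup (fun n => ((M n ω : ℝ) : EReal)) Filter.atTop = ⊤,
      ∃ M : ℕ → DoobSeq.Space → ℝ, DoobSeq.IsComputableRationalMartingale M ∧
        DoobSeq.Nonneg M ∧
          Filter.liminf (fun n => ((M n ω : ℝ) : EReal)) Filter.atTop = ⊤] := by
  tfae_have 1 → 4 := by
    intro h
    simp only [DoobSeq.DoobRandom, not_forall] at h
    obtain ⟨M, hM, hM0, hω⟩ := h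
    obtain ⟨W, hW, hW0, hWω⟩ := DoobSeq.exists_rationalMartingale_tendsto hM hM0 hω
    exact ⟨W, hW, hW0, (EReal.tendsto_coe_nhds_top_iff.2 hWω).liminf_eq⟩
  tfae_have 4 → 3 := by
    rintro ⟨M, hM, hM0, h⟩
    exact ⟨M, hM, hM0, top_le_iff.1 (h.symm.trans_le Filter.liminf_le_limsup)⟩
  tfae_have 3 → 2 := by
    rintro ⟨M, hM, hM0, h⟩
    exact ⟨M, hM, hM0, DoobSeq.not_convergesAt_of_limsup_eq_top h⟩
  tfae_have 2 → 1 := by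
    rintro ⟨M, hM, hM0, h⟩ hω
    exact h (hω M hM.isComputableMartingale hM0)
  tfae_finish
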